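/- All spaces are real. A normed space $X$ is transitive if for all $x,y\in X$ with $\|x\|=\|y\|=1$ there is a linear surjective isometry $T$ of $X$ with $Tx=y$. A subspace $Y\subset X$ is 1-complemented if there is a linear projection of $X$ onto $Y$ of norm at most $1$. For a normed space $Y$ put $$\delta_Y(\varepsilon)=\inf\Big\{1-\Big\|\frac{x+y}2\Big\| : \|x\|\le 1,\ \|y\|\le 1,\ \|x-y\|\ge\varepsilon\Big\},\qquad \rho_Y(\tau)=\sup\Big\{\frac{\|x+\tau y\|+\|x-\tau y\|}2-1 : \|x\|=\|y\|=1\Big\}$$ (the infimum of the empty set is $+\infty$, its supremum $-\infty$). Corollary (modulus of convexity and smoothness of power type 2). Let $X$ be a separable transitive Banach space. Then every 1-complemented finite-dimensional subspace $Y$ of $X$ has modulus of convexity and modulus of smoothness of power type 2: there are constants $c,C>0$ such that $\delta_Y(\varepsilon)\ge c\,\varepsilon^2$ for all $0<\varepsilon\le 2$ and $\rho_Y(\tau)\le C\tau^2$ for all $\tau>0$. In particular, if $1\le p\le\infty$, $p\ne2$ and $n\ge2$, then no 1-complemented subspace of $X$ is linearly isometric to $\ell_p^n$. -/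

import Mathlib

/-- A normed space is transitive if its group of linear surjective isometries acts transitively
on the unit sphere. -/
def IsTransitiveSpace (X : Type*) [NormedAddCommGroup X] [NormedSpace ℝ X] : Prop :=
  ∀ x y : X, ‖x‖ = 1 → ‖y‖ = 1 → ∃ T : X ≃ₗᵢ[ℝ] X, T x = y

/-- A subspace is 1-complemented if it is the range of a linear projection of norm at most 1. -/
def IsOneComplemented {X : Type*} [NormedAddCommGroup X] [NormedSpace ℝ X]
    (Y : Submodule ℝ X) : Prop :=
  ∃ P : X →L[ℝ] Y, (∀ y : Y, P (y : X) = y) ∧ ‖P‖ ≤ 1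

/-- The modulus of convexity: the infimum of `1 - ‖(x + y) / 2‖` over all `x`, `y` in the closed
unit ball with `‖x - y‖ ≥ ε`. It takes extended real values, so that an infimum over the empty set
(zero space) is `+∞`. -/
noncomputable def modulusOfConvexity (X : Type*) [NormedAddCommGroup X] [NormedSpace ℝ X]
    (ε : ℝ) : EReal :=
  ⨅ (x : X) (y : X) (_ : ‖x‖ ≤ 1) (_ : ‖y‖ ≤ 1) (_ : ε ≤ ‖x - y‖),
    ((1 - ‖(1 / 2 : ℝ) • (x + y)‖ : ℝ) : EReal)

/-- The modulus of smoothness: the supremum of `(‖x + τ y‖ + ‖x - τ y‖) / 2 - 1` over all `x`, `y`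
in the unit sphere, with extended real values. -/
noncomputable def modulusOfSmoothness (X : Type*) [NormedAddCommGroup X] [NormedSpace ℝ X]
    (τ : ℝ) : EReal :=
  ⨆ (x : X) (y : X) (_ : ‖x‖ = 1) (_ : ‖y‖ = 1),
    (((‖x + τ • y‖ + ‖x - τ • y‖) / 2 - 1 : ℝ) : EReal)

/-- The modulus of convexity is of power type `q`: it is at least `C * ε ^ q` on `(0, 2]`, for
some constant `C > 0`. -/
def HasConvexityPowerType (X : Type*) [NormedAddCommGroup X] [NormedSpace ℝ X] (q : ℝ) : Prop :=
  ∃ C : ℝ, 0 < C ∧ ∀ ε : ℝ, 0 < ε → ε ≤ 2 → ((C * ε ^ q : ℝ) : EReal) ≤ modulusOfConvexity X ε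

/-- The modulus of smoothness is of power type `q`: it is at most `C * τ ^ q` on `(0, ∞)`, for
some constant `C > 0`. -/
def HasSmoothnessPowerType (X : Type*) [NormedAddCommGroup X] [NormedSpace ℝ X] (q : ℝ) : Prop :=
  ∃ C : ℝ, 0 < C ∧ ∀ τ : ℝ, 0 < τ → modulusOfSmoothness X τ ≤ ((C * τ ^ q : ℝ) : EReal)

/-!
A finite-dimensional normed space always has a point of its unit sphere at which an ellipsoid
contained in the unit ball touches the sphere: fix a Euclidean norm and minimise it over the
sphere. Maximising it gives a point at which an ellipsoid containing the unit ball touches the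
sphere. If this happens at every point, with ellipsoids of bounded eccentricity, then the
parallelogram law bounds the modulus of smoothness (inner ellipsoids,
`HasInscribedEllipsoidAt.smoothness_le`) and the modulus of convexity (outer ellipsoids,
`HasCircumscribedEllipsoidAt.convexity_ge`) as in a Hilbert space.

So ellipsoids have to be moved along the unit sphere of a 1-complemented subspace `Y`. An isometry
of `X` does not preserve `Y`, but composed with the projection onto `Y` it gives a contraction `A`
of `Y`, and touching ellipsoids can be pulled back or pushed forward along `A` provided that `A`
is close to the identity and `A x = y`. Such contractions exist when `x` and `y` are close: since
`X` is separable, countably many closures of sets `{T x | T close on Y to a given operator}` cover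
the unit sphere of `X`, and Baire's theorem shows that every `y` near `x` is approximated by points
`T x` with `T` an isometry close to the identity on `Y` (`IsTransitiveSpace.exists_isometry_near`, a
weak form of Effros' microtransitivity theorem). Compactness of the set of contractions of `Y` makes
the approximation exact (`NearIdContracts.of_approx`). Connectedness and compactness of the unit
sphere of `Y` then carry touching ellipsoids from one point to all points, with a uniform bound
(`exists_uniform_on_sphere`).

In `ℓ_p^n` the norm of `e₁ + s e₂` is `(1 + s ^ p) ^ (1 / p)`, or `1` for `p = ∞` and `s ≤ 1`. As
`s → 0` this exceeds `1 + C s ^ 2` if `p < 2` and is below `1 + c s ^ 2` if `p > 2`.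
-/

/-! ### Isometries close to the identity on a finite-dimensional subspace -/

open TopologicalSpace Set Filter Topology in
/-- In a separable transitive Banach space, points `y` near `x` of the unit sphere can be
approximated by images `T x` under isometries `T` that are close to the identity on a given
finite-dimensional subspace. The radius `r` does not depend on the quality `ε` of the
approximation. -/
theorem IsTransitiveSpace.exists_isometry_near {X : Type*} [NormedAddCommGroup X]
    [NormedSpace ℝ X] [CompleteSpace X] [SeparableSpace X]
    (hX : IsTransitiveSpace X) (Y : Submodule ℝ X) [FiniteDimensional ℝ Y] {η : ℝ} (hη : 0 < η)
    {x : X} (hx : ‖x‖ = 1) :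
    ∃ r > 0, ∀ y : X, ‖y‖ = 1 → ‖y - x‖ < r → ∀ ε > 0, ∃ T : X ≃ₗᵢ[ℝ] X,
      ‖T x - y‖ < ε ∧ ∀ z ∈ Y, ‖T z - z‖ ≤ η * ‖z‖ := by
  have : SecondCountableTopology X := UniformSpace.secondCountable_of_separable X
  let S := Metric.sphere (0 : X) 1
  have : CompleteSpace S := Metric.isClosed_sphere.completeSpace_coe
  have : Nonempty S := ⟨⟨x, by simp [S, hx]⟩⟩
  let F : (X ≃ₗᵢ[ℝ] X) → (Y →L[ℝ] X) := fun T => (T : X →L[ℝ] X).comp Y.subtypeL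
  -- Operators `Y →L[ℝ] X` form a separable space, so countably many of the sets `O n` cover `S`.
  let O : ℕ → Set S := fun n =>
    {s | ∃ T : X ≃ₗᵢ[ℝ] X, ‖F T - denseSeq (Y →L[ℝ] X) n‖ < η / 2 ∧ (s : X) = T x}
  have hU : ⋃ n, closure (O n) = univ := by
    refine eq_univ_of_forall fun s => ?_
    obtain ⟨T, hT⟩ := hX x s hx (by simp)
    obtain ⟨n, hn⟩ := (denseRange_denseSeq (Y →L[ℝ] X)).exists_dist_lt (F T) (half_pos hη)
    exact mem_iUnion.2 ⟨n, subset_closure ⟨T, (dist_eq_norm (F T) _).symm.trans_lt hn, hT.symm⟩⟩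
  obtain ⟨n, hn⟩ := nonempty_interior_of_iUnion_of_closed (fun n => isClosed_closure) hU
  obtain ⟨s, hs, T₀, hT₀, hsT₀⟩ :=
    (mem_closure_iff.1 (interior_subset hn.some_mem)) _ isOpen_interior hn.some_mem
  obtain ⟨r, hr, hball⟩ := Metric.mem_nhds_iff.1 (isOpen_interior.mem_nhds hs)
  refine ⟨r, hr, fun y hy hyx ε hε => ?_⟩
  have hy' : (⟨T₀ y, by simp [S, hy]⟩ : S) ∈ closure (O n) := by
    refine interior_subset (hball ?_)
    rw [Metric.mem_ball, Subtype.dist_eq, hsT₀, T₀.dist_map, dist_eq_norm]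
    exact hyx
  obtain ⟨s₁, ⟨T₁, hT₁, hs₁⟩, hd⟩ := Metric.mem_closure_iff.1 hy' ε hε
  -- `T₀` and `T₁` are both within `η / 2` of the same operator on `Y`.
  refine ⟨T₁.trans T₀.symm, ?_, fun z hz => ?_⟩
  · rw [Subtype.dist_eq, hs₁, dist_comm, dist_eq_norm] at hd
    rw [← T₀.norm_map]
    simpa using hd
  · rw [← T₀.norm_map]
    have h1 : ‖F T₁ - F T₀‖ ≤ η := by
      have := norm_sub_le (F T₁ - denseSeq (Y →L[ℝ] X) n) (F T₀ - denseSeq (Y →L[ℝ] X) n)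
      rw [sub_sub_sub_cancel_right] at this
      linarith
    simpa [F] using (F T₁ - F T₀).le_of_opNorm_le h1 ⟨z, hz⟩

/-! ### Contractions close to the identity -/

/-- There is a contraction `A` of `V` at distance at most `1 / 2` from the identity such that
`A x = y`. -/
def NearIdContracts {V : Type*} [NormedAddCommGroup V] [NormedSpace ℝ V] (x y : V) : Prop :=
  ∃ A : V →L[ℝ] V, ‖A‖ ≤ 1 ∧ ‖A - ContinuousLinearMap.id ℝ V‖ ≤ 1 / 2 ∧ A x = y

/-- The contractions close to the identity form a compact set, so their values at `x` form a
closed set. -/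
theorem NearIdContracts.of_approx {V : Type*} [NormedAddCommGroup V] [NormedSpace ℝ V]
    [FiniteDimensional ℝ V] {x y : V}
    (h : ∀ ε > 0, ∃ A : V →L[ℝ] V, ‖A‖ ≤ 1 ∧ ‖A - ContinuousLinearMap.id ℝ V‖ ≤ 1 / 2 ∧
      ‖A x - y‖ < ε) : NearIdContracts x y := by
  have : ProperSpace (V →L[ℝ] V) := FiniteDimensional.proper ℝ _
  let K : Set (V →L[ℝ] V) :=
    Metric.closedBall 0 1 ∩ Metric.closedBall (ContinuousLinearMap.id ℝ V) (1 / 2)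
  have hK : IsCompact ((fun A : V →L[ℝ] V => A x) '' K) :=
    ((isCompact_closedBall _ _).inter_right Metric.isClosed_closedBall).image (by fun_prop)
  have hy : y ∈ closure ((fun A : V →L[ℝ] V => A x) '' K) := by
    refine Metric.mem_closure_iff.2 fun ε hε => ?_
    obtain ⟨A, h1, h2, h3⟩ := h ε hε
    refine ⟨A x, ⟨A, ⟨by simpa using h1, ?_⟩, rfl⟩, by rwa [dist_comm, dist_eq_norm]⟩
    rwa [Metric.mem_closedBall, dist_eq_norm]
  rw [hK.isClosed.closure_eq] at hy
  obtain ⟨A, ⟨h1, h2⟩, h3⟩ := hy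
  exact ⟨A, by simpa using h1, by rwa [Metric.mem_closedBall, dist_eq_norm] at h2, h3⟩

/-- Compressing isometries of `X` to a 1-complemented subspace `Y` gives contractions of `Y` in
both directions between nearby points of its unit sphere. -/
theorem IsTransitiveSpace.nearIdContracts {X : Type*} [NormedAddCommGroup X]
    [NormedSpace ℝ X] [CompleteSpace X] [TopologicalSpace.SeparableSpace X]
    (hX : IsTransitiveSpace X) {Y : Submodule ℝ X} [FiniteDimensional ℝ Y]
    (hY : IsOneComplemented Y) {x : Y} (hx : ‖x‖ = 1) :
    ∃ r > 0, ∀ y : Y, ‖y‖ = 1 → ‖y - x‖ < r → NearIdContracts x y ∧ NearIdContracts y x := by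
  obtain ⟨P, hP, hP1⟩ := hY
  obtain ⟨r, hr, H⟩ := hX.exists_isometry_near Y (η := 1 / 2) (by norm_num) (x := x) (by simpa)
  have compress : ∀ T : X ≃ₗᵢ[ℝ] X, (∀ z ∈ Y, ‖T z - z‖ ≤ 1 / 2 * ‖z‖) → ∀ u v : Y, ∀ ε,
      ‖T u - v‖ < ε → ∃ A : Y →L[ℝ] Y, ‖A‖ ≤ 1 ∧ ‖A - ContinuousLinearMap.id ℝ Y‖ ≤ 1 / 2 ∧
        ‖A u - v‖ < ε := by
    intro T hT u v ε h
    have hPle : ∀ w, ‖P w‖ ≤ ‖w‖ := fun w => by simpa using P.le_of_opNorm_le hP1 w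
    have key : ∀ u v : Y, ‖P (T u) - v‖ ≤ ‖T u - v‖ := fun u v => by
      simpa only [map_sub, hP] using hPle (T u - v)
    refine ⟨P.comp ((T : X →L[ℝ] X).comp Y.subtypeL), ?_, ?_, ?_⟩
    · refine ContinuousLinearMap.opNorm_le_bound _ zero_le_one fun z => ?_
      simpa using hPle (T z)
    · refine ContinuousLinearMap.opNorm_le_bound _ (by norm_num) fun z => ?_
      exact (key z z).trans (hT z z.2)
    · exact (key u v).trans_lt h
  refine ⟨r, hr, fun y hy hyx => ⟨.of_approx fun ε hε => ?_, .of_approx fun ε hε => ?_⟩⟩ <;>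
    obtain ⟨T, hTx, hT⟩ := H y (by simpa) (by simpa using hyx) ε hε
  · exact compress T hT x y ε hTx
  · refine compress T.symm (fun z hz => ?_) y x ε ?_
    · rw [← T.norm_map, map_sub, norm_sub_rev]
      simpa using hT z hz
    · rw [← T.norm_map, map_sub, norm_sub_rev]
      simpa using hTx

/-- Near-identity contractions are bounded below. -/
theorem norm_le_two_mul_norm_apply {V : Type*} [NormedAddCommGroup V] [NormedSpace ℝ V]
    {A : V →L[ℝ] V} (hA : ‖A - ContinuousLinearMap.id ℝ V‖ ≤ 1 / 2) (z : V) :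
    ‖z‖ ≤ 2 * ‖A z‖ := by
  have h1 : ‖A z - z‖ ≤ 1 / 2 * ‖z‖ := by
    simpa using (A - ContinuousLinearMap.id ℝ V).le_of_opNorm_le hA z
  have h2 := norm_sub_norm_le z (A z)
  rw [norm_sub_rev] at h2
  linarith

open Set Filter Topology in
/-- A property depending on a constant that holds somewhere on the unit sphere and passes along
near-identity contractions with a controlled loss in the constant holds on the whole unit sphere
with a single constant. -/
theorem exists_uniform_on_sphere {V : Type*} [NormedAddCommGroup V] [NormedSpace ℝ V]
    [FiniteDimensional ℝ V]
    (hV : ∀ x : V, ‖x‖ = 1 → ∃ r > 0, ∀ y : V, ‖y‖ = 1 → ‖y - x‖ < r →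
      NearIdContracts x y ∧ NearIdContracts y x)
    {R : ℝ → V → Prop} (mono : ∀ M N x, M ≤ N → R M x → R N x)
    (neg : ∀ M x, R M x → R M (-x))
    (transfer : ∀ M x y, NearIdContracts x y → NearIdContracts y x → R M x → R (2 * M) y)
    {x₀ : V} (hx₀ : ‖x₀‖ = 1) {M₀ : ℝ} (h₀ : R M₀ x₀) :
    ∃ M, ∀ x, ‖x‖ = 1 → R M x := by
  have pointwise : ∀ x, ‖x‖ = 1 → ∃ M, R M x := by
    intro x hx
    by_cases hdim : 1 < Module.rank ℝ V
    · have := (isPreconnected_sphere hdim (0 : V) 1).induction₂'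
        (fun x y => (∃ M, R M x) → ∃ M, R M y) (fun x hx => ?_)
        (fun _ _ _ _ _ _ h h' => h' ∘ h) (x := x₀) (y := x) (by simpa) (by simpa)
      · exact this ⟨M₀, h₀⟩
      · obtain ⟨r, hr, H⟩ := hV x (by simpa using hx)
        filter_upwards [mem_nhdsWithin_of_mem_nhds (Metric.ball_mem_nhds x hr),
          self_mem_nhdsWithin] with y hyx hy
        obtain ⟨h1, h2⟩ := H y (by simpa using hy) (by rwa [Metric.mem_ball, dist_eq_norm] at hyx)
        exact ⟨fun ⟨M, hM⟩ => ⟨_, transfer M _ _ h1 h2 hM⟩,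
          fun ⟨M, hM⟩ => ⟨_, transfer M _ _ h2 h1 hM⟩⟩
    -- In dimension one the sphere is disconnected, but consists of `x₀` and `-x₀` only.
    · obtain ⟨v, hv⟩ := rank_le_one_iff.1 (not_lt.1 hdim)
      obtain ⟨a, rfl⟩ := hv x₀
      obtain ⟨b, rfl⟩ := hv x
      rw [norm_smul, Real.norm_eq_abs] at hx hx₀
      have hv0 : ‖v‖ ≠ 0 := fun h => by simp [h] at hx
      have hab : |b| = |a| := mul_right_cancel₀ hv0 (hx.trans hx₀.symm)
      rcases abs_eq_abs.1 hab with rfl | rfl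
      · exact ⟨M₀, h₀⟩
      · exact ⟨M₀, by simpa using neg _ _ h₀⟩
  have := (isCompact_sphere (0 : V) 1).induction_on (p := fun s => ∃ M, ∀ x ∈ s, R M x)
    ⟨0, by simp⟩ (fun s t hst ⟨M, hM⟩ => ⟨M, fun x hx => hM x (hst hx)⟩)
    (fun s t ⟨M, hM⟩ ⟨N, hN⟩ => ⟨max M N, fun x hx => hx.elim
      (fun h => mono _ _ _ (le_max_left _ _) (hM x h))
      (fun h => mono _ _ _ (le_max_right _ _) (hN x h))⟩) (fun x hx => ?_)
  · simpa using this
  · have hx : ‖x‖ = 1 := by simpa using hx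
    obtain ⟨r, hr, H⟩ := hV x hx
    obtain ⟨M, hM⟩ := pointwise x hx
    refine ⟨Metric.ball x r ∩ Metric.sphere 0 1, inter_mem
      (mem_nhdsWithin_of_mem_nhds (Metric.ball_mem_nhds x hr)) self_mem_nhdsWithin,
      2 * M, fun y hy => ?_⟩
    obtain ⟨h1, h2⟩ := H y (by simpa using hy.2) (by simpa [dist_eq_norm] using hy.1)
    exact transfer _ _ _ h1 h2 hM

/-! ### Ellipsoids touching the unit sphere -/

/-- The unit ball of `V` contains an ellipsoid, centred at the origin, that touches the unit
sphere at `x`, and contains the ball of radius `1 / M`. The ellipsoid is the preimage of the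
Euclidean unit ball under the linear map `Φ`. -/
def HasInscribedEllipsoidAt {V : Type*} [NormedAddCommGroup V] [NormedSpace ℝ V]
    (M : ℝ) (x : V) : Prop :=
  ∃ Φ : V →ₗ[ℝ] EuclideanSpace ℝ (Fin (Module.finrank ℝ V)), ‖Φ x‖ = 1 ∧
    ∀ z, ‖z‖ ≤ ‖Φ z‖ ∧ ‖Φ z‖ ≤ M * ‖z‖

/-- The unit ball of `V` lies in an ellipsoid, centred at the origin, that touches the unit
sphere at `x`, and that is contained in the ball of radius `M`. The ellipsoid is the preimage of
the Euclidean unit ball under the linear map `Φ`. -/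
def HasCircumscribedEllipsoidAt {V : Type*} [NormedAddCommGroup V] [NormedSpace ℝ V]
    (M : ℝ) (x : V) : Prop :=
  ∃ Φ : V →ₗ[ℝ] EuclideanSpace ℝ (Fin (Module.finrank ℝ V)), ‖Φ x‖ = 1 ∧
    ∀ z, ‖Φ z‖ ≤ ‖z‖ ∧ ‖z‖ ≤ M * ‖Φ z‖

section

variable {V : Type*} [NormedAddCommGroup V] [NormedSpace ℝ V]

/-- The image of a touching inner ellipsoid under the contraction is again one: it stays in the unit
ball, and contains the image `y` of the contact point. -/
theorem HasInscribedEllipsoidAt.transfer [FiniteDimensional ℝ V] {M : ℝ} {x y : V}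
    (h : HasInscribedEllipsoidAt M x) (hxy : NearIdContracts x y) :
    HasInscribedEllipsoidAt (2 * M) y := by
  obtain ⟨Φ, hΦx, hΦ⟩ := h
  obtain ⟨A, hA1, hA, rfl⟩ := hxy
  have hinj : Function.Injective (A : V →ₗ[ℝ] V) := by
    refine (injective_iff_map_eq_zero _).2 fun z hz => ?_
    have hz : A z = 0 := hz
    simpa [hz] using norm_le_two_mul_norm_apply hA z
  let e := LinearEquiv.ofInjectiveEndo (A : V →ₗ[ℝ] V) hinj
  have he : ∀ z, e.symm (A z) = z := fun z => e.symm_apply_apply z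
  refine ⟨Φ ∘ₗ e.symm.toLinearMap, by simpa [he] using hΦx, fun w => ?_⟩
  obtain ⟨z, rfl⟩ : ∃ z, A z = w := e.surjective w
  simp only [LinearMap.comp_apply, LinearEquiv.coe_coe, he]
  have hle : ‖A z‖ ≤ ‖z‖ := by simpa using A.le_of_opNorm_le hA1 z
  refine ⟨hle.trans (hΦ z).1, ?_⟩
  rcases eq_or_ne z 0 with rfl | hz
  · simp
  · have hM : 0 ≤ M := by
      have := (norm_nonneg _).trans (hΦ z).2
      exact nonneg_of_mul_nonneg_left this (norm_pos_iff.2 hz)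
    have := mul_le_mul_of_nonneg_left (norm_le_two_mul_norm_apply hA z) hM
    linarith [(hΦ z).2]

/-- The preimage of a touching outer ellipsoid under the contraction is again one. In contrast to
inner ellipsoids, these move against the direction of the contraction. -/
theorem HasCircumscribedEllipsoidAt.transfer {M : ℝ} {x y : V}
    (h : HasCircumscribedEllipsoidAt M x) (hyx : NearIdContracts y x) :
    HasCircumscribedEllipsoidAt (2 * M) y := by
  obtain ⟨Φ, hΦx, hΦ⟩ := h
  obtain ⟨A, hA1, hA, rfl⟩ := hyx
  refine ⟨Φ ∘ₗ A.toLinearMap, hΦx, fun z => ?_⟩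
  have hle : ‖A z‖ ≤ ‖z‖ := by simpa using A.le_of_opNorm_le hA1 z
  have h1 : ‖z‖ ≤ 2 * ‖A z‖ := norm_le_two_mul_norm_apply hA z
  have h2 := hΦ (A z)
  simp only [LinearMap.comp_apply, ContinuousLinearMap.coe_coe]
  exact ⟨h2.1.trans hle, by linarith⟩

theorem exists_hasInscribedEllipsoidAt [FiniteDimensional ℝ V] [Nontrivial V] :
    ∃ x : V, ‖x‖ = 1 ∧ ∃ M, HasInscribedEllipsoidAt M x := by
  let φ : V ≃L[ℝ] EuclideanSpace ℝ (Fin (Module.finrank ℝ V)) := toEuclidean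
  obtain ⟨x, hx, hmin⟩ := (isCompact_sphere (0 : V) 1).exists_isMinOn
    (NormedSpace.sphere_nonempty.2 zero_le_one) (f := fun z => ‖φ z‖) (by fun_prop)
  have hx : ‖x‖ = 1 := by simpa using hx
  have hpos : 0 < ‖φ x‖ := by
    rw [norm_pos_iff, Ne, EmbeddingLike.map_eq_zero_iff]
    rintro rfl
    simp at hx
  refine ⟨x, hx, ‖φ x‖⁻¹ * ‖φ.toContinuousLinearMap‖, ‖φ x‖⁻¹ • φ.toLinearMap, ?_,
    fun z => ⟨?_, ?_⟩⟩
  · simp [norm_smul, hpos.ne']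
  · rcases eq_or_ne z 0 with rfl | hz
    · simp
    · have h : ‖φ x‖ ≤ ‖φ (‖z‖⁻¹ • z)‖ := hmin (by simp [norm_smul, hz])
      have hz' := norm_pos_iff.2 hz
      rw [map_smul, norm_smul, norm_inv, norm_norm, le_inv_mul_iff₀ hz'] at h
      have : ‖z‖ ≤ ‖φ x‖⁻¹ * ‖φ z‖ := by rwa [le_inv_mul_iff₀ hpos, mul_comm]
      simpa [norm_smul] using this
  · have := mul_le_mul_of_nonneg_left (φ.toContinuousLinearMap.le_opNorm z) (inv_nonneg.2 hpos.le)
    simpa [norm_smul, mul_assoc] using this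

theorem exists_hasCircumscribedEllipsoidAt [FiniteDimensional ℝ V] [Nontrivial V] :
    ∃ x : V, ‖x‖ = 1 ∧ ∃ M, HasCircumscribedEllipsoidAt M x := by
  let φ : V ≃L[ℝ] EuclideanSpace ℝ (Fin (Module.finrank ℝ V)) := toEuclidean
  obtain ⟨x, hx, hmax⟩ := (isCompact_sphere (0 : V) 1).exists_isMaxOn
    (NormedSpace.sphere_nonempty.2 zero_le_one) (f := fun z => ‖φ z‖) (by fun_prop)
  have hx : ‖x‖ = 1 := by simpa using hx
  have hpos : 0 < ‖φ x‖ := by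
    rw [norm_pos_iff, Ne, EmbeddingLike.map_eq_zero_iff]
    rintro rfl
    simp at hx
  refine ⟨x, hx, ‖φ x‖ * ‖φ.symm.toContinuousLinearMap‖, ‖φ x‖⁻¹ • φ.toLinearMap, ?_,
    fun z => ⟨?_, ?_⟩⟩
  · simp [norm_smul, hpos.ne']
  · rcases eq_or_ne z 0 with rfl | hz
    · simp
    · have h : ‖φ (‖z‖⁻¹ • z)‖ ≤ ‖φ x‖ := hmax (by simp [norm_smul, hz])
      have hz' := norm_pos_iff.2 hz
      rw [map_smul, norm_smul, norm_inv, norm_norm, inv_mul_le_iff₀ hz'] at h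
      have : ‖φ x‖⁻¹ * ‖φ z‖ ≤ ‖z‖ := by rwa [inv_mul_le_iff₀ hpos, mul_comm]
      simpa [norm_smul] using this
  · have h : ‖z‖ ≤ ‖φ.symm.toContinuousLinearMap‖ * ‖φ z‖ := by
      simpa using φ.symm.toContinuousLinearMap.le_opNorm (φ z)
    have h' : ‖φ x‖ * ‖φ.symm.toContinuousLinearMap‖ * (‖φ x‖⁻¹ * ‖φ z‖)
        = ‖φ.symm.toContinuousLinearMap‖ * ‖φ z‖ := by
      field_simp
    rw [← h'] at h
    simpa [norm_smul] using h

/-! ### Power type two from touching ellipsoids -/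

theorem HasInscribedEllipsoidAt.smoothness_le {M τ : ℝ} {x y : V}
    (h : HasInscribedEllipsoidAt M x) (hy : ‖y‖ = 1) :
    (‖x + τ • y‖ + ‖x - τ • y‖) / 2 - 1 ≤ M ^ 2 / 2 * τ ^ 2 := by
  obtain ⟨Φ, hΦx, hΦ⟩ := h
  have h1 := (hΦ (x + τ • y)).1
  have h2 := (hΦ (x - τ • y)).1
  have h3 : ‖Φ y‖ ≤ M := by simpa [hy] using (hΦ y).2
  have h4 : ‖Φ y‖ ^ 2 ≤ M ^ 2 := by gcongr
  have h5 := parallelogram_law_with_norm ℝ (Φ x) (τ • Φ y)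
  rw [map_add, map_smul] at h1
  rw [map_sub, map_smul] at h2
  rw [hΦx, norm_smul, Real.norm_eq_abs] at h5
  set a := ‖Φ x + τ • Φ y‖
  set b := ‖Φ x - τ • Φ y‖
  have h6 : (|τ| * ‖Φ y‖) * (|τ| * ‖Φ y‖) ≤ M ^ 2 * τ ^ 2 := by
    calc _ = ‖Φ y‖ ^ 2 * τ ^ 2 := by rw [← sq_abs τ]; ring
      _ ≤ _ := by gcongr
  nlinarith [sq_nonneg (a - 1), sq_nonneg (b - 1)]

/-- The midpoint of `u` and `v` is `t • x`, where `t` is its norm and the ellipsoid touches the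
sphere at `x`; stated in this form, the midpoint `0` needs no separate treatment. -/
theorem HasCircumscribedEllipsoidAt.convexity_ge {M ε : ℝ} {u v : V} (hM : 1 ≤ M) (hε : 0 ≤ ε)
    (hu : ‖u‖ ≤ 1) (hv : ‖v‖ ≤ 1) (huv : ε ≤ ‖u - v‖) {x : V}
    (h : HasCircumscribedEllipsoidAt M x) {t : ℝ} (ht : 0 ≤ t) (hx : (1 / 2 : ℝ) • (u + v) = t • x)
    (ht' : ‖(1 / 2 : ℝ) • (u + v)‖ = t) :
    (8 * M ^ 2)⁻¹ * ε ^ 2 ≤ 1 - ‖(1 / 2 : ℝ) • (u + v)‖ := by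
  obtain ⟨Φ, hΦx, hΦ⟩ := h
  have hM0 : 0 < M := by linarith
  have h1 : ‖Φ u‖ ≤ 1 := (hΦ u).1.trans hu
  have h2 : ‖Φ v‖ ≤ 1 := (hΦ v).1.trans hv
  have h3 : ‖Φ u + Φ v‖ = 2 * t := by
    have : Φ u + Φ v = (2 * t) • Φ x := by
      rw [← map_add, mul_smul, ← map_smul, ← map_smul, ← hx, smul_smul]
      norm_num
    rw [this, norm_smul, hΦx, Real.norm_of_nonneg (by positivity), mul_one]
  have h4 : ε ≤ M * ‖Φ u - Φ v‖ := by
    rw [← map_sub]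
    exact huv.trans (hΦ _).2
  have h5 := parallelogram_law_with_norm ℝ (Φ u) (Φ v)
  have h6 : ε ^ 2 ≤ M ^ 2 * ‖Φ u - Φ v‖ ^ 2 := by
    rw [← mul_pow]
    gcongr
  have h7 : ‖Φ u - Φ v‖ ^ 2 ≤ 8 * (1 - t) := by
    rw [h3] at h5
    nlinarith [sq_nonneg (t - 1), norm_nonneg (Φ u), norm_nonneg (Φ v)]
  rw [ht', inv_mul_le_iff₀ (by positivity)]
  calc ε ^ 2 ≤ M ^ 2 * ‖Φ u - Φ v‖ ^ 2 := h6
    _ ≤ M ^ 2 * (8 * (1 - t)) := by gcongr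
    _ = _ := by ring

theorem hasSmoothnessPowerType_two_of_inscribed {M : ℝ}
    (h : ∀ x : V, ‖x‖ = 1 → HasInscribedEllipsoidAt M x) : HasSmoothnessPowerType V 2 := by
  -- The summand `1` keeps the constant positive when the sphere is empty and `M = 0`.
  refine ⟨M ^ 2 / 2 + 1, by positivity, fun τ hτ => ?_⟩
  simp only [modulusOfSmoothness, iSup_le_iff, EReal.coe_le_coe_iff, Real.rpow_two]
  intro x y hx hy
  have := (h x hx).smoothness_le (τ := τ) hy
  nlinarith [sq_nonneg τ]

theorem hasConvexityPowerType_two_of_circumscribed [Nontrivial V] {M : ℝ}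
    (h : ∀ x : V, ‖x‖ = 1 → HasCircumscribedEllipsoidAt M x) : HasConvexityPowerType V 2 := by
  obtain ⟨x₀, hx₀⟩ := exists_norm_eq V zero_le_one
  have hM : 1 ≤ M := by
    obtain ⟨Φ, h1, h2⟩ := h x₀ hx₀
    simpa [h1, hx₀] using (h2 x₀).2
  refine ⟨(8 * M ^ 2)⁻¹, by positivity, fun ε hε _ => ?_⟩
  simp only [modulusOfConvexity, le_iInf_iff, EReal.coe_le_coe_iff, Real.rpow_two]
  intro u v hu hv huv
  rcases eq_or_ne ((1 / 2 : ℝ) • (u + v)) 0 with hm | hm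
  · exact (h x₀ hx₀).convexity_ge hM hε.le hu hv huv le_rfl (by rw [hm, zero_smul])
      (by rw [hm, norm_zero])
  · have hm' := norm_ne_zero_iff.2 hm
    refine (h (‖(1 / 2 : ℝ) • (u + v)‖⁻¹ • (1 / 2 : ℝ) • (u + v)) ?_).convexity_ge hM hε.le
      hu hv huv (norm_nonneg _) ?_ rfl
    · rw [norm_smul, norm_inv, norm_norm, inv_mul_cancel₀ hm']
    · rw [smul_inv_smul₀ hm']

/-- Power type two holds whenever nearby points of the unit sphere are related by near-identity
contractions in both directions: outer ellipsoids give convexity, inner ones smoothness. -/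
theorem powerType_two_of_nearIdContracts [FiniteDimensional ℝ V]
    (hV : ∀ x : V, ‖x‖ = 1 → ∃ r > 0, ∀ y : V, ‖y‖ = 1 → ‖y - x‖ < r →
      NearIdContracts x y ∧ NearIdContracts y x) :
    HasConvexityPowerType V 2 ∧ HasSmoothnessPowerType V 2 := by
  rcases subsingleton_or_nontrivial V with hs | hn
  · refine ⟨⟨1, one_pos, fun ε hε _ => ?_⟩, ⟨1, one_pos, fun τ _ => ?_⟩⟩
    · simp only [modulusOfConvexity, le_iInf_iff]
      intro x y _ _ hxy
      rw [Subsingleton.elim x y, sub_self, norm_zero] at hxy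
      exact absurd hxy hε.not_ge
    · simp only [modulusOfSmoothness, iSup_le_iff]
      intro x y hx
      rw [Subsingleton.elim x 0, norm_zero] at hx
      exact absurd hx zero_ne_one
  constructor
  · obtain ⟨x₀, hx₀, M₀, h₀⟩ := exists_hasCircumscribedEllipsoidAt (V := V)
    obtain ⟨M, hM⟩ := exists_uniform_on_sphere hV (R := HasCircumscribedEllipsoidAt)
      (fun M N x hMN ⟨Φ, h1, h2⟩ => ⟨Φ, h1, fun z => ⟨(h2 z).1, (h2 z).2.trans (by gcongr)⟩⟩)
      (fun M x ⟨Φ, h1, h2⟩ => ⟨Φ, by simpa using h1, h2⟩)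
      (fun M x y _ hyx h => h.transfer hyx) hx₀ h₀
    exact hasConvexityPowerType_two_of_circumscribed hM
  · obtain ⟨x₀, hx₀, M₀, h₀⟩ := exists_hasInscribedEllipsoidAt (V := V)
    obtain ⟨M, hM⟩ := exists_uniform_on_sphere hV (R := HasInscribedEllipsoidAt)
      (fun M N x hMN ⟨Φ, h1, h2⟩ => ⟨Φ, h1, fun z => ⟨(h2 z).1, (h2 z).2.trans (by gcongr)⟩⟩)
      (fun M x ⟨Φ, h1, h2⟩ => ⟨Φ, by simpa using h1, h2⟩)
      (fun M x y hxy _ h => h.transfer hxy) hx₀ h₀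
    exact hasSmoothnessPowerType_two_of_inscribed hM

end

/-! ### Planes isometric to a two-dimensional `ℓ_p` space -/

open Filter Topology in
/-- If `a ≤ b * s ^ r` with `r > 0` for small `s > 0`, then `a ≤ 0`. -/
theorem nonpos_of_forall_le_mul_rpow {a b r : ℝ} (hr : 0 < r)
    (h : ∀ s : ℝ, 0 < s → s ≤ 1 → a ≤ b * s ^ r) : a ≤ 0 := by
  have h1 : Tendsto (fun s : ℝ => b * s ^ r) (𝓝[>] 0) (𝓝 0) := by
    have : ContinuousAt (fun s : ℝ => b * s ^ r) 0 :=
      continuousAt_const.mul (Real.continuousAt_rpow_const _ _ (Or.inr hr.le))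
    simpa [ContinuousAt, Real.zero_rpow hr.ne'] using this.mono_left nhdsWithin_le_nhds
  refine ge_of_tendsto h1 ?_
  filter_upwards [Ioc_mem_nhdsGT (zero_lt_one (α := ℝ))] with s hs
  exact h s hs.1 hs.2

section

variable {V : Type*} [NormedAddCommGroup V] [NormedSpace ℝ V] {e f : V}

/-- If the norm is symmetric along `f` about `e`, then the average in the modulus of smoothness is
`‖e + s f‖`. -/
theorem HasSmoothnessPowerType.norm_add_smul_le (h : HasSmoothnessPowerType V 2)
    (he : ‖e‖ = 1) (hf : ‖f‖ = 1) (hsymm : ∀ s : ℝ, ‖e - s • f‖ = ‖e + s • f‖) :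
    ∃ C > 0, ∀ s : ℝ, 0 < s → ‖e + s • f‖ ≤ 1 + C * s ^ 2 := by
  obtain ⟨C, hC, H⟩ := h
  refine ⟨C, hC, fun s hs => ?_⟩
  have := H s hs
  simp only [modulusOfSmoothness, iSup_le_iff, EReal.coe_le_coe_iff, Real.rpow_two] at this
  have := this e f he hf
  rw [hsymm] at this
  linarith

/-- If the norm is symmetric along `f` about `e`, then the modulus of convexity applies to the unit
vectors obtained by normalising `e + s f` and `e - s f`, whose midpoint is a multiple of `e`. -/
theorem HasConvexityPowerType.le_norm_add_smul (h : HasConvexityPowerType V 2)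
    (he : ‖e‖ = 1) (hf : ‖f‖ = 1) (hsymm : ∀ s : ℝ, |s| ≤ 1 → ‖e - s • f‖ = ‖e + s • f‖) :
    ∃ C > 0, ∀ s : ℝ, 0 < s → s ≤ 1 → 1 + C * s ^ 2 ≤ ‖e + s • f‖ := by
  obtain ⟨C, hC, H⟩ := h
  refine ⟨2 * C, by positivity, fun s hs hs1 => ?_⟩
  have hsymm := hsymm s (by rwa [abs_of_pos hs])
  set N := ‖e + s • f‖ with hN
  have hsf : ‖s • f‖ = s := by rw [norm_smul, hf, Real.norm_of_nonneg hs.le, mul_one]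
  have hN1 : 1 ≤ N := by
    have := norm_add_le (e + s • f) (e - s • f)
    rw [hsymm, add_add_sub_cancel, ← two_smul ℝ e, norm_smul, he] at this
    norm_num at this
    linarith
  have hN2 : N ≤ 2 := by linarith [norm_add_le e (s • f)]
  have hN0 : 0 < N := by linarith
  have hle : 2 * s / N ≤ 2 := by rw [div_le_iff₀ hN0]; linarith
  have := H (2 * s / N) (by positivity) hle
  simp only [modulusOfConvexity, le_iInf_iff, EReal.coe_le_coe_iff, Real.rpow_two] at this
  have hsub : N⁻¹ • (e + s • f) - N⁻¹ • (e - s • f) = (2 * s / N) • f := by module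
  have hadd : (1 / 2 : ℝ) • (N⁻¹ • (e + s • f) + N⁻¹ • (e - s • f)) = N⁻¹ • e := by module
  have := this (N⁻¹ • (e + s • f)) (N⁻¹ • (e - s • f))
    (by rw [norm_smul, ← hN, norm_inv, Real.norm_of_nonneg hN0.le, inv_mul_cancel₀ hN0.ne'])
    (by rw [norm_smul, hsymm, norm_inv, Real.norm_of_nonneg hN0.le,
      inv_mul_cancel₀ hN0.ne'])
    (by rw [hsub, norm_smul, hf, mul_one]; exact Real.le_norm_self _)
  rw [hadd, norm_smul, he, norm_inv, Real.norm_of_nonneg hN0.le, mul_one] at this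
  have h1 : C * (4 * s ^ 2) ≤ N * (N - 1) := by
    have h2 := mul_le_mul_of_nonneg_right this (sq_nonneg N)
    have h3 : C * (2 * s / N) ^ 2 * N ^ 2 = C * (4 * s ^ 2) := by field_simp; ring
    have h4 : (1 - N⁻¹) * N ^ 2 = N * (N - 1) := by field_simp
    rwa [h3, h4] at h2
  nlinarith

/-- The norm of `e + s f` for two unit vectors `e`, `f` spanning a copy of the `ℓ_p` plane grows
like `1 + s ^ p / p`, which is not of the order of `1 + s ^ 2` unless `p = 2`. -/
theorem eq_two_of_powerType_two (hc : HasConvexityPowerType V 2) (hs : HasSmoothnessPowerType V 2)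
    (he : ‖e‖ = 1) (hf : ‖f‖ = 1) {p : ℝ} (hp : 1 ≤ p)
    (hnorm : ∀ s : ℝ, ‖e + s • f‖ ^ p = 1 + |s| ^ p) : p = 2 := by
  have hp0 : p ≠ 0 := by linarith
  have hsymm : ∀ s : ℝ, ‖e - s • f‖ = ‖e + s • f‖ := fun s => by
    have h := hnorm (-s)
    rw [abs_neg, ← hnorm s, neg_smul, ← sub_eq_add_neg] at h
    exact (Real.rpow_left_inj (norm_nonneg _) (norm_nonneg _) hp0).1 h
  rcases lt_trichotomy p 2 with h | h | h
  · exfalso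
    obtain ⟨C, hC, H⟩ := hs.norm_add_smul_le he hf hsymm
    have : (1 : ℝ) ≤ 0 := by
      refine nonpos_of_forall_le_mul_rpow (b := 2 * C + C ^ 2) (sub_pos.2 h) fun s h0 h1 => ?_
      have h2 : 1 + s ^ p ≤ (1 + C * s ^ 2) ^ 2 := by
        calc 1 + s ^ p = ‖e + s • f‖ ^ p := by rw [hnorm, abs_of_pos h0]
          _ ≤ (1 + C * s ^ 2) ^ p := by
            gcongr
            exact H s h0
          _ ≤ (1 + C * s ^ 2) ^ (2 : ℝ) := by
            refine Real.rpow_le_rpow_of_exponent_le ?_ h.le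
            nlinarith [sq_nonneg s]
          _ = _ := Real.rpow_two _
      have h3 : s ^ 4 ≤ s ^ 2 := pow_le_pow_of_le_one h0.le h1 (by norm_num)
      have h4 : s ^ p ≤ (2 * C + C ^ 2) * s ^ 2 := by nlinarith [sq_nonneg C]
      rw [Real.rpow_sub h0, Real.rpow_two, ← mul_div_assoc, le_div_iff₀ (by positivity), one_mul]
      exact h4
    linarith
  · exact h
  · exfalso
    obtain ⟨C, hC, H⟩ := hc.le_norm_add_smul he hf fun s _ => hsymm s
    have : C ≤ 0 := by
      refine nonpos_of_forall_le_mul_rpow (b := 1) (sub_pos.2 h) fun s h0 h1 => ?_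
      have h2 : 1 + C * s ^ 2 ≤ 1 + s ^ p := by
        have h3 := H s h0 h1
        calc 1 + C * s ^ 2 ≤ ‖e + s • f‖ := h3
          _ = ‖e + s • f‖ ^ (1 : ℝ) := (Real.rpow_one _).symm
          _ ≤ ‖e + s • f‖ ^ p := by
            refine Real.rpow_le_rpow_of_exponent_le ?_ hp
            nlinarith [sq_nonneg s]
          _ = 1 + s ^ p := by rw [hnorm, abs_of_pos h0]
      rw [Real.rpow_sub h0, Real.rpow_two, one_mul, le_div_iff₀ (by positivity)]
      linarith
    linarith

end

theorem PiLp.norm_single_add_smul_single_rpow {ι : Type*} [Fintype ι] [DecidableEq ι]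
    {p : ENNReal} (hp : 0 < p.toReal) {i j : ι} (hij : i ≠ j) (s : ℝ) :
    ‖(PiLp.single p i 1 + s • PiLp.single p j 1 : PiLp p (fun _ : ι => ℝ))‖ ^ p.toReal
      = 1 + |s| ^ p.toReal := by
  rw [PiLp.norm_eq_sum hp, one_div, Real.rpow_inv_rpow (by positivity) hp.ne',
    Fintype.sum_eq_add i j hij]
  · simp [hij, hij.symm]
  · rintro k ⟨hi, hj⟩
    simp [hi, hj, Real.zero_rpow hp.ne']

theorem PiLp.norm_single_add_smul_single_top {ι : Type*} [Fintype ι] [DecidableEq ι]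
    {i j : ι} (hij : i ≠ j) {s : ℝ} (hs : |s| ≤ 1) :
    ‖(PiLp.single ⊤ i 1 + s • PiLp.single ⊤ j 1 : PiLp ⊤ (fun _ : ι => ℝ))‖ = 1 := by
  have : Nonempty ι := ⟨i⟩
  rw [PiLp.norm_eq_ciSup]
  refine le_antisymm (ciSup_le fun k => ?_) ?_
  · rcases eq_or_ne k i with rfl | hi
    · simp [hij]
    · rcases eq_or_ne k j with rfl | hj
      · simpa [hi] using hs
      · simp [hi, hj]
  · refine le_ciSup_of_le (Finite.bddAbove_range _) i ?_
    simp [hij]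

/-! ### One-complemented subspaces of separable transitive spaces -/

theorem mainTheorem7 (X : Type*) [NormedAddCommGroup X] [NormedSpace ℝ X] [CompleteSpace X]
    [TopologicalSpace.SeparableSpace X] (hX : IsTransitiveSpace X) :
    (∀ Y : Submodule ℝ X, FiniteDimensional ℝ Y → IsOneComplemented Y →
      HasConvexityPowerType Y 2 ∧ HasSmoothnessPowerType Y 2) ∧
    (∀ (p : ENNReal) [Fact (1 ≤ p)] (n : ℕ), p ≠ 2 → 2 ≤ n →
      ¬ ∃ Y : Submodule ℝ X, IsOneComplemented Y ∧
        Nonempty (PiLp p (fun _ : Fin n => ℝ) ≃ₗᵢ[ℝ] Y)) := by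
  have main : ∀ Y : Submodule ℝ X, FiniteDimensional ℝ Y → IsOneComplemented Y →
      HasConvexityPowerType Y 2 ∧ HasSmoothnessPowerType Y 2 := fun Y _ hY =>
    powerType_two_of_nearIdContracts fun _ hx => hX.nearIdContracts hY hx
  refine ⟨main, ?_⟩
  rintro p hp n hp2 hn ⟨Y, hY, ⟨φ⟩⟩
  have hfin : FiniteDimensional ℝ Y := φ.toLinearEquiv.finiteDimensional
  obtain ⟨hc, hs⟩ := main Y hfin hY
  let i : Fin n := ⟨0, by omega⟩
  let j : Fin n := ⟨1, by omega⟩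
  have hij : i ≠ j := by simp [i, j]
  have hunit : ∀ k : Fin n, ‖φ (PiLp.single p k 1)‖ = 1 := fun k => by simp
  have hφ : ∀ s : ℝ, ‖φ (PiLp.single p i 1) + s • φ (PiLp.single p j 1)‖
      = ‖(PiLp.single p i 1 + s • PiLp.single p j 1 : PiLp p (fun _ : Fin n => ℝ))‖ := fun s => by
    rw [← map_smul, ← map_add, φ.norm_map]
  rcases eq_or_ne p ⊤ with rfl | hpt
  · obtain ⟨C, hC, H⟩ := hc.le_norm_add_smul (hunit i) (hunit j) fun s hs => by
      rw [sub_eq_add_neg, ← neg_smul, hφ, hφ, PiLp.norm_single_add_smul_single_top hij hs,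
        PiLp.norm_single_add_smul_single_top hij (by rwa [abs_neg])]
    have := H 1 one_pos le_rfl
    rw [hφ, PiLp.norm_single_add_smul_single_top hij (by simp)] at this
    linarith
  · have hp1 : 1 ≤ p.toReal := by simpa using ENNReal.toReal_mono hpt hp.out
    have h2 := eq_two_of_powerType_two hc hs (hunit i) (hunit j) hp1 fun s => by
      rw [hφ, PiLp.norm_single_add_smul_single_rpow (by linarith) hij]
    exact hp2 ((ENNReal.toReal_eq_toReal_iff' hpt (by simp)).1 (by simpa using h2))
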